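/- Let $T=\{0,1\}^*$ be the rooted tree of finite binary words, in which each word $w$ is joined to $w0$ and $w1$, and let $G\le\mathrm{Aut}(T)$ be the Grigorchuk group, i.e. the subgroup generated by the automorphisms $a,b,c,d$ defined recursively by $$a(0w)=1w,\quad a(1w)=0w,\qquad b(0w)=0a(w),\quad b(1w)=1c(w),$$ $$c(0w)=0a(w),\quad c(1w)=1d(w),\qquad d(0w)=0w,\quad d(1w)=1b(w)$$ (all four fix the empty word). Let $\Gamma_n$ be the Schreier graph of the action of $G$ on $\{0,1\}^n$ with respect to $\{a,b,c,d\}$ (vertex set $\{0,1\}^n$, edges $(x,sx)$ for $s\in\{a,b,c,d\}$), and let $d_n$ be its graph distance. For a group $H$ with a finite symmetric generating set $S$ and an $H$-set $X$, let $\Gamma(H,X)$ denote the Schreier graph of the action, $d$ its graph distance, and $\mathrm{vol}_{H,X}(n)=\max_{x\in X}|B_H(n)\cdot x|$, where $B_H(n)$ is the ball of radius $n$ around the identity for the word metric of $S$. The action has orbits of controlled diameter if all $H$-orbits in $X$ are finite and there is $C>0$ such that for every non-trivial $h\in H$ there are an $H$-orbit $O\subset X$ and $x\in O$ with $hx\ne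 x$ and $\mathrm{diam}(\Gamma(H,O))\le C\,d(x,hx)$. For $f\colon\mathbb N\to\mathbb N$, let $\mathcal C_{\mathrm{CD}}(f)$ be the class of finitely generated groups $H$ that admit an action on a set $X$ with orbits of controlled diameter and such that, for some integer $C>0$, $\mathrm{vol}_{H,X}(n)\le C f(Cn)$ for all $n\ge1$ (these conditions do not depend on the choice of $S$). Write $\mathcal C_{\mathrm{CD}}(\mathrm{lin})$ for the case $f(n)=n$. Then for every non-trivial $g\in G$ there exist $n\ge 1$ and $w\in\{0,1\}^n$ such that $$d_n(gw,w)\ \ge\ \tfrac18\,\mathrm{diam}(\Gamma_n).$$ In particular, $G$ belongs to $\mathcal C_{\mathrm{CD}}(\mathrm{lin})$. -/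

import Mathlib

universe u

/-! ### Schreier graphs, growth of actions, and the class `C_CD(f)` -/

section Actions

variable {G : Type u} [Group G]

/-- The Schreier graph of an action of `G` on `X` with respect to `S ⊆ G`: the points `x` and
`s • x` are joined for all `s ∈ S`. Loops and multiplicities of edges are discarded, as they do
not influence distances. -/
def schreierGraph (S : Set G) (X : Type*) [MulAction G X] : SimpleGraph X :=
  SimpleGraph.fromRel fun x y => ∃ s ∈ S, s • x = y

/-- The ball of radius `n` around `1` for the word metric of the symmetric generating set `S`. -/
def wordBall (S : Set G) (n : ℕ) : Set G :=
  {g | ∃ l : List G, l.length ≤ n ∧ (∀ s ∈ l, s ∈ S) ∧ l.prod = g}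

/-- The growth of the action of `G` on `X`: the largest cardinality of `B_G(n) • x`. -/
noncomputable def actionGrowth (S : Set G) (X : Type*) [MulAction G X] (n : ℕ) : ℕ∞ :=
  ⨆ x : X, ((fun g : G => g • x) '' wordBall S n).encard

/-- The relation `f₁ ≼ f₂`: there is `C > 0` with `f₁ n ≤ C f₂ (C n)` for all `n ≥ 1`. -/
def GrowthLE (f₁ f₂ : ℕ → ℕ∞) : Prop :=
  ∃ C : ℕ, 0 < C ∧ ∀ n : ℕ, 1 ≤ n → f₁ n ≤ C * f₂ (C * n)

/-- The action of `G` on `X` has orbits of controlled diameter (with respect to `S`): all orbits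
are finite, and there is `C > 0` such that each non-trivial `g` moves some point `x` with
`diam (Γ(G, O)) ≤ C d(x, g x)`, where `O` is the orbit of `x`. -/
def HasOrbitsOfControlledDiameter (S : Set G) (X : Type*) [MulAction G X] : Prop :=
  (∀ x : X, (MulAction.orbit G x).Finite) ∧
    ∃ C : ℝ, 0 < C ∧ ∀ g : G, g ≠ 1 → ∃ x : X, g • x ≠ x ∧
      ((schreierGraph S (MulAction.orbit G x)).diam : ℝ) ≤
        C * ((schreierGraph S X).dist x (g • x) : ℝ)

end Actions

/-- The class `C_CD(f)`: the finitely generated groups that admit an action with orbits of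
controlled diameter and with growth `≼ f`, for some finite symmetric generating set (neither
property depends on the generating set). -/
def InClassCD (f : ℕ → ℕ) (G : Type u) [Group G] : Prop :=
  ∃ S : Set G, S.Finite ∧ (∀ s ∈ S, s⁻¹ ∈ S) ∧ Subgroup.closure S = ⊤ ∧
    ∃ (X : Type u) (_ : MulAction G X),
      HasOrbitsOfControlledDiameter S X ∧
        GrowthLE (actionGrowth S X) (fun n => (f n : ℕ∞))

/-! ### The binary tree and its automorphism group -/

/-- In the rooted binary tree, `v` is a child of `u` if `v = ux` for a letter `x`.
The letters `0`, `1` are `false`, `true`. -/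
def IsChild (u v : List Bool) : Prop := ∃ x : Bool, v = u ++ [x]

/-- The automorphism group of the rooted tree of finite binary words. -/
def treeAut : Subgroup (Equiv.Perm (List Bool)) where
  carrier := {g | g [] = [] ∧ ∀ u v, IsChild (g u) (g v) ↔ IsChild u v}
  one_mem' := ⟨rfl, fun _ _ => Iff.rfl⟩
  mul_mem' := by
    rintro g h ⟨hg, hg'⟩ ⟨hh, hh'⟩
    refine ⟨by simp [hh, hg], fun u v => ?_⟩
    rw [Equiv.Perm.mul_apply, Equiv.Perm.mul_apply, hg', hh']
  inv_mem' := by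
    rintro g ⟨hg, hg'⟩
    refine ⟨by rw [Equiv.Perm.inv_eq_iff_eq, hg], fun u v => ?_⟩
    rw [← hg' (g⁻¹ u) (g⁻¹ v)]
    simp

theorem treeAut_length (g : treeAut) (w : List Bool) :
    ((g : Equiv.Perm (List Bool)) w).length = w.length := by
  induction w using List.reverseRecOn with
  | nil => rw [g.2.1]
  | append_singleton u x ih =>
    obtain ⟨y, hy⟩ := (g.2.2 u (u ++ [x])).2 ⟨x, rfl⟩
    rw [hy, List.length_append, List.length_append, ih]
    rfl

/-- The `n`-th level `{0, 1}ⁿ` of the binary tree. -/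
def Level (n : ℕ) : Type := {w : List Bool // w.length = n}

/-- The action of the automorphism group of the tree on the `n`-th level. -/
instance Level.instMulAction (n : ℕ) : MulAction treeAut (Level n) where
  smul g w := ⟨(g : Equiv.Perm (List Bool)) w.1, (treeAut_length g w.1).trans w.2⟩
  one_smul _ := rfl
  mul_smul _ _ _ := rfl

/-! ### The Grigorchuk group -/

/-- `a(0w) = 1w`, `a(1w) = 0w`. -/
def grigAFun : List Bool → List Bool
  | [] => []
  | x :: w => (!x) :: w

mutual

/-- `b(0w) = 0a(w)`, `b(1w) = 1c(w)`. -/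
def grigBFun : List Bool → List Bool
  | [] => []
  | false :: w => false :: grigAFun w
  | true :: w => true :: grigCFun w

/-- `c(0w) = 0a(w)`, `c(1w) = 1d(w)`. -/
def grigCFun : List Bool → List Bool
  | [] => []
  | false :: w => false :: grigAFun w
  | true :: w => true :: grigDFun w

/-- `d(0w) = 0w`, `d(1w) = 1b(w)`. -/
def grigDFun : List Bool → List Bool
  | [] => []
  | false :: w => false :: w
  | true :: w => true :: grigBFun w

end

theorem grigAFun_involutive : Function.Involutive grigAFun := by
  intro w
  cases w <;> simp [grigAFun]

theorem grigBCDFun_involutive (w : List Bool) :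
    grigBFun (grigBFun w) = w ∧ grigCFun (grigCFun w) = w ∧ grigDFun (grigDFun w) = w := by
  induction w with
  | nil => simp [grigBFun, grigCFun, grigDFun]
  | cons x w ih =>
    cases x <;> simp [grigBFun, grigCFun, grigDFun, grigAFun_involutive w, ih]

theorem grigAFun_isChild (u : List Bool) (x : Bool) :
    IsChild (grigAFun u) (grigAFun (u ++ [x])) := by
  cases u with
  | nil => exact ⟨!x, rfl⟩
  | cons y u => exact ⟨x, rfl⟩

theorem IsChild.cons {u v : List Bool} (h : IsChild u v) (y : Bool) :
    IsChild (y :: u) (y :: v) := by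
  obtain ⟨x, rfl⟩ := h
  exact ⟨x, rfl⟩

theorem grigBCDFun_isChild (u : List Bool) (x : Bool) :
    IsChild (grigBFun u) (grigBFun (u ++ [x])) ∧
    IsChild (grigCFun u) (grigCFun (u ++ [x])) ∧
    IsChild (grigDFun u) (grigDFun (u ++ [x])) := by
  induction u with
  | nil =>
    cases x <;> simp [grigBFun, grigCFun, grigDFun, grigAFun, IsChild]
  | cons y u ih =>
    cases y
    · simp only [List.cons_append, grigBFun, grigCFun, grigDFun]
      exact ⟨(grigAFun_isChild u x).cons _, (grigAFun_isChild u x).cons _,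
        IsChild.cons ⟨x, rfl⟩ _⟩
    · simp only [List.cons_append, grigBFun, grigCFun, grigDFun]
      exact ⟨ih.2.1.cons _, ih.2.2.cons _, ih.1.cons _⟩

/-- An involution of the set of words that fixes the root and maps children to children is an
automorphism of the tree. -/
def treeAutOfInvolutive (f : List Bool → List Bool) (hf : Function.Involutive f)
    (h0 : f [] = []) (hc : ∀ u x, IsChild (f u) (f (u ++ [x]))) : treeAut :=
  ⟨hf.toPerm f, h0, fun u v => by
    have key : ∀ u v, IsChild u v → IsChild (f u) (f v) := by
      rintro u _ ⟨x, rfl⟩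
      exact hc u x
    refine ⟨fun h => ?_, key u v⟩
    have h2 := key _ _ h
    simpa only [Function.Involutive.coe_toPerm, hf u, hf v] using h2⟩

/-- The generator `a`. -/
def grigA : treeAut :=
  treeAutOfInvolutive grigAFun grigAFun_involutive rfl grigAFun_isChild

/-- The generator `b`. -/
def grigB : treeAut :=
  treeAutOfInvolutive grigBFun (fun w => (grigBCDFun_involutive w).1) (by simp [grigBFun])
    (fun u x => (grigBCDFun_isChild u x).1)

/-- The generator `c`. -/
def grigC : treeAut :=
  treeAutOfInvolutive grigCFun (fun w => (grigBCDFun_involutive w).2.1) (by simp [grigCFun])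
    (fun u x => (grigBCDFun_isChild u x).2.1)

/-- The generator `d`. -/
def grigD : treeAut :=
  treeAutOfInvolutive grigDFun (fun w => (grigBCDFun_involutive w).2.2) (by simp [grigDFun])
    (fun u x => (grigBCDFun_isChild u x).2.2)

/-- The Grigorchuk group, generated by `a, b, c, d` in the automorphism group of the tree. -/
def grigorchukGroup : Subgroup treeAut :=
  Subgroup.closure {grigA, grigB, grigC, grigD}

/-- The generating set `{a, b, c, d}`, as a subset of the Grigorchuk group. -/
def grigorchukGenerators : Set grigorchukGroup :=
  {s | (s : treeAut) ∈ ({grigA, grigB, grigC, grigD} : Set treeAut)}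

/-- The Schreier graph `Γ_n` of the action of the Grigorchuk group on the level `{0, 1}ⁿ`. -/
def grigorchukSchreierGraph (n : ℕ) : SimpleGraph (Level n) :=
  schreierGraph grigorchukGenerators (Level n)

/-! The Schreier graph `Γ_n` is a segment with `2ⁿ` vertices, along which the reflected Gray code
`grayPos` gives the position of a word. Each generator moves a position by at most one, so
differences of positions bound distances from below, and balls of radius `r` have at most `2r + 1`
points.

For `g ≠ 1`, some vertex `v` of the last level that `g` fixes pointwise is such that `g` exchanges
`v0` and `v1`. These lie symmetrically about the middle of their segment, and `v1` has the same
position as `v`, so they are far apart unless `v` is near the far end of its level. To avoid that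
end, let `σ_n : Aut(T) → {±1}` be the sign of the action on `{0, 1}ⁿ`. For `n ≥ 2` the recursion
gives `σ_n(a) = 1`, `σ_{n+1}(b) = σ_n(c)`, `σ_{n+1}(c) = σ_n(d)` and `σ_{n+1}(d) = σ_n(b)`, so
`bcd = 1` implies that `σ_n σ_{n+1} σ_{n+2}` is trivial on `G`. An element of `G` that is trivial on
the third level thus cannot act on the fourth as a single transposition. Applied to the section of
`g` at the prefix of `v` that omits its last three letters, this lets us change these three letters,
and with them the eighth of the segment that contains `v`.
-/

section Potentials

variable {G : Type u} [Group G] {S : Set G} {X : Type*} [MulAction G X]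

theorem diam_lt_natCard {V : Type*} [Finite V] [Nonempty V] (H : SimpleGraph V) :
    H.diam < Nat.card V := by
  have := Fintype.ofFinite V
  by_cases hc : H.Connected
  · obtain ⟨u, v, huv⟩ := H.exists_dist_eq_diam
    obtain ⟨p, hp, hlen⟩ := (hc u v).exists_path_of_dist
    rw [← huv, ← hlen, Nat.card_eq_fintype_card]
    exact hp.length_lt
  · rw [SimpleGraph.diam_eq_zero_of_not_connected hc]
    exact Nat.card_pos

theorem reachable_smul_of_mem {s : G} (hs : s ∈ S) (x : X) :
    (schreierGraph S X).Reachable x (s • x) := by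
  by_cases h : x = s • x
  · rw [← h]
  · exact SimpleGraph.Adj.reachable ((SimpleGraph.fromRel_adj _ _ _).2 ⟨h, Or.inl ⟨s, hs, rfl⟩⟩)

theorem reachable_smul_of_mem_closure {g : G} (hg : g ∈ Subgroup.closure S) (x : X) :
    (schreierGraph S X).Reachable x (g • x) := by
  induction hg using Subgroup.closure_induction generalizing x with
  | mem s hs => exact reachable_smul_of_mem hs x
  | one => rw [one_smul]
  | mul g h _ _ ihg ihh => rw [mul_smul]; exact (ihh x).trans (ihg _)
  | inv g _ ih => simpa only [smul_inv_smul] using (ih (g⁻¹ • x)).symm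

/-- An integer-valued function that each element of `S` changes by at most one. Such functions
bound distances in the Schreier graph from below. -/
def IsLipschitzPotential (S : Set G) (F : X → ℤ) : Prop :=
  ∀ s ∈ S, ∀ x, |F (s • x) - F x| ≤ 1

namespace IsLipschitzPotential

variable {F : X → ℤ}

theorem abs_sub_le_length (hF : IsLipschitzPotential S F) {x y : X}
    (p : (schreierGraph S X).Walk x y) : |F y - F x| ≤ p.length := by
  induction p with
  | nil => simp
  | @cons x y z hadj p ih =>
    have hstep : |F y - F x| ≤ 1 := by
      obtain ⟨s, hs, rfl⟩ | ⟨s, hs, rfl⟩ := ((SimpleGraph.fromRel_adj _ _ _).1 hadj).2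
      · exact hF s hs x
      · exact abs_sub_comm (F y) _ ▸ hF s hs y
    rw [SimpleGraph.Walk.length_cons, Nat.cast_succ]
    exact (abs_sub_le _ (F y) _).trans (add_le_add ih hstep)

theorem abs_sub_smul_le_dist (hF : IsLipschitzPotential S F) (hS : Subgroup.closure S = ⊤)
    (g : G) (x : X) : |F (g • x) - F x| ≤ (schreierGraph S X).dist x (g • x) := by
  have hreach := reachable_smul_of_mem_closure (hS ▸ Subgroup.mem_top g) x
  obtain ⟨p, hp⟩ := hreach.exists_walk_length_eq_dist
  exact hp ▸ hF.abs_sub_le_length p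

theorem abs_sub_smul_le_of_mem_wordBall (hF : IsLipschitzPotential S F) {n : ℕ} {g : G}
    (hg : g ∈ wordBall S n) (x : X) : |F (g • x) - F x| ≤ n := by
  obtain ⟨l, hl, hS, rfl⟩ := hg
  suffices h : |F (l.prod • x) - F x| ≤ l.length from h.trans (by exact_mod_cast hl)
  clear hl
  induction l with
  | nil => simp
  | cons s l ih =>
    have hprod := ih fun t ht => hS t (List.mem_cons_of_mem _ ht)
    have hstep := hF s (hS s List.mem_cons_self) (l.prod • x)
    rw [List.prod_cons, mul_smul, List.length_cons, Nat.cast_succ, add_comm]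
    exact (abs_sub_le _ (F (l.prod • x)) _).trans (add_le_add hstep hprod)

theorem actionGrowth_le (hF : IsLipschitzPotential S F)
    (hinj : ∀ x, Set.InjOn F (MulAction.orbit G x)) (n : ℕ) :
    actionGrowth S X n ≤ (2 * n + 1 : ℕ) := by
  refine iSup_le fun x => ?_
  have hball : (fun g : G => g • x) '' wordBall S n ⊆ MulAction.orbit G x :=
    Set.image_subset_range _ _
  have himage : F '' ((fun g : G => g • x) '' wordBall S n) ⊆
      (Finset.Icc (F x - n) (F x + n) : Finset ℤ) := by
    rintro _ ⟨_, ⟨g, hg, rfl⟩, rfl⟩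
    have := abs_le.1 (hF.abs_sub_smul_le_of_mem_wordBall hg x)
    rw [Finset.mem_coe, Finset.mem_Icc]
    constructor <;> linarith
  rw [← ((hinj x).mono hball).encard_image]
  refine (Set.encard_le_encard himage).trans ?_
  rw [Set.encard_coe_eq_coe_finsetCard, Int.card_Icc]
  exact_mod_cast (by omega)

theorem growthLE_linear (hF : IsLipschitzPotential S F)
    (hinj : ∀ x, Set.InjOn F (MulAction.orbit G x)) :
    GrowthLE (actionGrowth S X) (fun n => (n : ℕ∞)) := by
  refine ⟨2, two_pos, fun n hn => (hF.actionGrowth_le hinj n).trans ?_⟩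
  have : 2 * n + 1 ≤ 2 * (2 * n) := by omega
  beta_reduce
  exact_mod_cast this

theorem hasOrbitsOfControlledDiameter (hF : IsLipschitzPotential S F)
    (hS : Subgroup.closure S = ⊤) (hfin : ∀ x : X, (MulAction.orbit G x).Finite) {C : ℝ}
    (hC : 0 < C)
    (hdisp : ∀ g : G, g ≠ 1 → ∃ x : X, g • x ≠ x ∧
      (Nat.card (MulAction.orbit G x) : ℝ) ≤ C * |F (g • x) - F x| + 1) :
    HasOrbitsOfControlledDiameter S X := by
  refine ⟨hfin, C, hC, fun g hg => ?_⟩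
  obtain ⟨x, hgx, hcard⟩ := hdisp g hg
  refine ⟨x, hgx, ?_⟩
  have := (hfin x).to_subtype
  have : Nonempty (MulAction.orbit G x) := ⟨⟨x, MulAction.mem_orbit_self x⟩⟩
  have hdiam : ((schreierGraph S (MulAction.orbit G x)).diam : ℝ) + 1 ≤
      Nat.card (MulAction.orbit G x) := by
    exact_mod_cast diam_lt_natCard (schreierGraph S (MulAction.orbit G x))
  have hdist : (|F (g • x) - F x| : ℝ) ≤ (schreierGraph S X).dist x (g • x) := by
    exact_mod_cast hF.abs_sub_smul_le_dist hS g x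
  have hscaled := mul_le_mul_of_nonneg_left hdist hC.le
  push_cast at hcard
  linarith

end IsLipschitzPotential

end Potentials

namespace Level

instance instFintype (n : ℕ) : Fintype (Level n) := inferInstanceAs (Fintype (List.Vector Bool n))

instance instDecidableEq (n : ℕ) : DecidableEq (Level n) :=
  inferInstanceAs (DecidableEq {w : List Bool // w.length = n})

instance instNonempty (n : ℕ) : Nonempty (Level n) := ⟨⟨List.replicate n true, by simp⟩⟩

theorem card (n : ℕ) : Fintype.card (Level n) = 2 ^ n :=
  card_vector (α := Bool) n

/-- Words of length `n + 1` as pairs consisting of the first letter and the remaining word. -/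
def consEquiv (n : ℕ) : Bool × Level n ≃ Level (n + 1) where
  toFun p := ⟨p.1 :: p.2.1, by rw [List.length_cons, p.2.2]⟩
  invFun
    | ⟨x :: w, h⟩ => (x, ⟨w, Nat.succ_injective h⟩)
  left_inv _ := rfl
  right_inv
    | ⟨_ :: _, _⟩ => rfl

end Level

section TreeAutomorphisms

theorem exists_smul_append_singleton (g : treeAut) (v : List Bool) (x : Bool) :
    ∃ y, g • (v ++ [x]) = g • v ++ [y] :=
  (g.2.2 v (v ++ [x])).2 ⟨x, rfl⟩

/-- The automorphism `g` fixes the vertex `v` and exchanges its two children. -/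
def SwapsChildren (g : treeAut) (v : List Bool) : Prop :=
  g • v = v ∧ ∀ x, g • (v ++ [x]) = v ++ [!x]

theorem swapsChildren_or_fixes_children {g : treeAut} {v : List Bool} (hv : g • v = v) :
    SwapsChildren g v ∨ ∀ x, g • (v ++ [x]) = v ++ [x] := by
  obtain ⟨y, hy⟩ := exists_smul_append_singleton g v false
  obtain ⟨z, hz⟩ := exists_smul_append_singleton g v true
  have hne : y ≠ z := by
    rintro rfl
    simpa using smul_left_cancel g (hy.trans hz.symm)
  rw [hv] at hy hz
  cases y <;> cases z
  · exact absurd rfl hne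
  · exact Or.inr (Bool.rec hy hz)
  · exact Or.inl ⟨hv, Bool.rec hy hz⟩
  · exact absurd rfl hne

theorem exists_swapsChildren_of_ne_one {g : treeAut} (hg : g ≠ 1) :
    ∃ v, SwapsChildren g v ∧ ∀ u : List Bool, u.length ≤ v.length → g • u = u := by
  have hmoved : ∃ w : List Bool, g • w ≠ w := by
    by_contra! hfix
    exact hg (Subtype.ext (Equiv.ext hfix))
  obtain ⟨w, hmin⟩ := exists_minimalFor_of_wellFoundedLT _ List.length hmoved
  have hgw : g • w ≠ w := hmin.prop
  have hfix (u : List Bool) (hu : u.length < w.length) : g • u = u :=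
    of_not_not (hmin.not_prop_of_lt hu)
  obtain rfl | ⟨v, x, rfl⟩ := w.eq_nil_or_concat'
  · exact absurd g.2.1 hgw
  rw [List.length_append, List.length_singleton] at hfix
  refine ⟨v, ?_, fun u hu => hfix u (by omega)⟩
  exact (swapsChildren_or_fixes_children (hfix v (by omega))).resolve_right fun h => hgw (h x)

/-- The automorphism `h` is the section of `g` at `w`, that is, the action of `g` on the subtree
hanging at `w`, once this subtree and its image are both identified with the whole tree. -/
def IsSectionAt (g h : treeAut) (w : List Bool) : Prop :=
  ∀ u : List Bool, g • (w ++ u) = g • w ++ h • u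

namespace IsSectionAt

variable {g g' h h' : treeAut} {w u : List Bool}

theorem nil (g : treeAut) : IsSectionAt g g [] := fun u => by
  have hroot : g • ([] : List Bool) = [] := g.2.1
  rw [hroot, List.nil_append, List.nil_append]

theorem append (hg : IsSectionAt g g' w) (hg' : IsSectionAt g' h u) : IsSectionAt g h (w ++ u) :=
  fun v => by rw [List.append_assoc, hg, hg', hg, List.append_assoc]

theorem one (w : List Bool) : IsSectionAt 1 1 w := fun u => by simp only [one_smul]

theorem mul (hg : IsSectionAt g g' (h • w)) (hh : IsSectionAt h h' w) :
    IsSectionAt (g * h) (g' * h') w :=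
  fun u => by rw [mul_smul, hh, hg, mul_smul, mul_smul]

theorem inv (hg : IsSectionAt g g' (g⁻¹ • w)) : IsSectionAt g⁻¹ g'⁻¹ w := fun u => by
  rw [inv_smul_eq_iff, hg, smul_inv_smul, smul_inv_smul]

theorem of_smul_cons {x y : Bool} (hg : ∀ u : List Bool, g • (x :: u) = y :: h • u) :
    IsSectionAt g h [x] := fun u => by
  have hroot : h • ([] : List Bool) = [] := h.2.1
  rw [List.singleton_append, hg, hg, hroot, List.singleton_append]

theorem smul_eq_iff (hg : IsSectionAt g h w) (hw : g • w = w) (u v : List Bool) :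
    g • (w ++ u) = w ++ v ↔ h • u = v := by
  rw [hg, hw, List.append_cancel_left_eq]

theorem swapsChildren_iff (hg : IsSectionAt g h w) (hw : g • w = w) (u : List Bool) :
    SwapsChildren g (w ++ u) ↔ SwapsChildren h u := by
  simp only [SwapsChildren, List.append_assoc, hg.smul_eq_iff hw]

end IsSectionAt

/-- The signature of the permutation of the level `{0, 1}ⁿ` induced by a tree automorphism. -/
def levelSign (n : ℕ) : treeAut →* ℤˣ :=
  Equiv.Perm.sign.comp (MulAction.toPermHom treeAut (Level n))

theorem levelSign_eq_one {g : treeAut} {n : ℕ} (hg : ∀ u : List Bool, u.length = n → g • u = u) :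
    levelSign n g = 1 := by
  have htriv : MulAction.toPermHom treeAut (Level n) g = 1 :=
    Equiv.ext fun w => Subtype.ext (hg w.1 w.2)
  rw [levelSign, MonoidHom.comp_apply, htriv, map_one]

theorem levelSign_succ_of_fixes_first_letter {g : treeAut} {h : Bool → treeAut}
    (hg : ∀ x (w : List Bool), g • (x :: w) = x :: h x • w) (n : ℕ) :
    levelSign (n + 1) g = ∏ x, levelSign n (h x) :=
  (Equiv.Perm.sign_eq_sign_of_equiv (Equiv.prodCongrRight fun x => MulAction.toPerm (h x))
    (MulAction.toPerm g) (Level.consEquiv n) fun p => Subtype.ext (hg p.1 p.2.1).symm).symm.trans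
    (Equiv.Perm.sign_prodCongrRight _)

theorem levelSign_succ_eq_neg_one {g : treeAut} {n : ℕ}
    (hg : ∀ u : List Bool, u.length = n → g • u = u) {v : List Bool} (hv : v.length = n)
    (hgv : SwapsChildren g v)
    (hother : ∀ u : List Bool, u.length = n → u ≠ v → ¬ SwapsChildren g u) :
    levelSign (n + 1) g = -1 := by
  let child (x : Bool) : Level (n + 1) := ⟨v ++ [x], by simp [hv]⟩
  have hne : child true ≠ child false := fun h => by simpa [child] using congrArg Subtype.val h
  have hswap : MulAction.toPermHom treeAut (Level (n + 1)) g =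
      Equiv.swap (child true) (child false) := by
    refine Equiv.ext fun w => ?_
    obtain ⟨w, hw⟩ := w
    obtain rfl | ⟨u, x, rfl⟩ := w.eq_nil_or_concat'
    · simp at hw
    have hu : u.length = n := by simpa using hw
    change (⟨g • (u ++ [x]), _⟩ : Level (n + 1)) = _
    by_cases huv : u = v
    · subst huv
      simp only [hgv.2]
      cases x
      · exact (Equiv.swap_apply_right _ _).symm
      · exact (Equiv.swap_apply_left _ _).symm
    · have hnot (y : Bool) : (⟨u ++ [x], hw⟩ : Level (n + 1)) ≠ child y :=
        fun h => huv (List.append_inj_left' (congrArg Subtype.val h) rfl)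
      have hchild := (swapsChildren_or_fixes_children (hg u hu)).resolve_left (hother u hu huv)
      simp only [hchild]
      exact (Equiv.swap_apply_of_ne_of_ne (hnot _) (hnot _)).symm
  rw [levelSign, MonoidHom.comp_apply, hswap, Equiv.Perm.sign_swap hne]

end TreeAutomorphisms

section GrigorchukGroup

theorem grigA_smul_cons (x : Bool) (w : List Bool) : grigA • (x :: w) = (!x) :: w := rfl

theorem grigB_smul_cons (x : Bool) (w : List Bool) :
    grigB • (x :: w) = x :: (bif x then grigC else grigA) • w := by
  cases x <;> rfl

theorem grigC_smul_cons (x : Bool) (w : List Bool) :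
    grigC • (x :: w) = x :: (bif x then grigD else grigA) • w := by
  cases x <;> rfl

theorem grigD_smul_cons (x : Bool) (w : List Bool) :
    grigD • (x :: w) = x :: (bif x then grigB else 1) • w := by
  cases x <;> rfl

theorem generator_mul_self {s : treeAut} (hs : s ∈ ({grigA, grigB, grigC, grigD} : Set treeAut)) :
    s * s = 1 := by
  refine Subtype.ext (Equiv.ext fun w => ?_)
  rcases hs with rfl | rfl | rfl | rfl
  · exact grigAFun_involutive w
  · exact (grigBCDFun_involutive w).1
  · exact (grigBCDFun_involutive w).2.1
  · exact (grigBCDFun_involutive w).2.2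

theorem grigBCDFun_comp (w : List Bool) :
    grigCFun (grigDFun w) = grigBFun w ∧ grigDFun (grigBFun w) = grigCFun w ∧
      grigBFun (grigCFun w) = grigDFun w := by
  induction w with
  | nil => simp [grigBFun, grigCFun, grigDFun]
  | cons x w ih =>
    cases x <;> simp [grigBFun, grigCFun, grigDFun, grigAFun_involutive w, ih]

theorem grigB_mul_grigC : grigB * grigC = grigD :=
  Subtype.ext (Equiv.ext fun w => (grigBCDFun_comp w).2.2)

theorem generator_inv {s : treeAut} (hs : s ∈ ({grigA, grigB, grigC, grigD} : Set treeAut)) :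
    s⁻¹ = s :=
  inv_eq_of_mul_eq_one_left (generator_mul_self hs)

theorem exists_isSectionAt_singleton_of_generator {s : treeAut}
    (hs : s ∈ ({1, grigA, grigB, grigC, grigD} : Set treeAut)) (x : Bool) :
    ∃ t ∈ ({1, grigA, grigB, grigC, grigD} : Set treeAut), IsSectionAt s t [x] := by
  rcases hs with rfl | rfl | rfl | rfl | rfl
  · exact ⟨1, by simp, .one [x]⟩
  · exact ⟨1, by simp, .of_smul_cons (grigA_smul_cons x)⟩
  · exact ⟨_, by cases x <;> simp, .of_smul_cons (grigB_smul_cons x)⟩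
  · exact ⟨_, by cases x <;> simp, .of_smul_cons (grigC_smul_cons x)⟩
  · exact ⟨_, by cases x <;> simp, .of_smul_cons (grigD_smul_cons x)⟩

theorem exists_isSectionAt_of_generator {s : treeAut}
    (hs : s ∈ ({1, grigA, grigB, grigC, grigD} : Set treeAut)) (w : List Bool) :
    ∃ t ∈ ({1, grigA, grigB, grigC, grigD} : Set treeAut), IsSectionAt s t w := by
  induction w generalizing s with
  | nil => exact ⟨s, hs, .nil s⟩
  | cons x w ih =>
    obtain ⟨t, ht, hst⟩ := exists_isSectionAt_singleton_of_generator hs x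
    obtain ⟨r, hr, htr⟩ := ih ht
    exact ⟨r, hr, hst.append htr⟩

theorem exists_isSectionAt {g : treeAut} (hg : g ∈ grigorchukGroup) (w : List Bool) :
    ∃ h ∈ grigorchukGroup, IsSectionAt g h w := by
  induction hg using Subgroup.closure_induction generalizing w with
  | mem s hs =>
    obtain ⟨t, rfl | ht, hst⟩ := exists_isSectionAt_of_generator (Set.mem_insert_of_mem 1 hs) w
    · exact ⟨1, one_mem _, hst⟩
    · exact ⟨t, Subgroup.subset_closure ht, hst⟩
  | one => exact ⟨1, one_mem _, .one w⟩
  | mul g h _ _ ihg ihh =>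
    obtain ⟨h', hh', hsec⟩ := ihh w
    obtain ⟨g', hg', gsec⟩ := ihg (h • w)
    exact ⟨g' * h', mul_mem hg' hh', gsec.mul hsec⟩
  | inv g _ ih =>
    obtain ⟨g', hg', gsec⟩ := ih (g⁻¹ • w)
    exact ⟨g'⁻¹, inv_mem hg', gsec.inv⟩

theorem levelSign_grigA (n : ℕ) : levelSign (n + 2) grigA = 1 := by
  have hsign : levelSign (n + 2) grigA = ∏ _w : Level (n + 1), Equiv.Perm.sign Equiv.boolNot :=
    (Equiv.Perm.sign_eq_sign_of_equiv (Equiv.prodCongrLeft fun _ => Equiv.boolNot)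
      (MulAction.toPerm grigA) (Level.consEquiv (n + 1)) fun _ => rfl).symm.trans
      (Equiv.Perm.sign_prodCongrLeft _)
  rw [hsign, Finset.prod_const, Finset.card_univ, Level.card, pow_succ, pow_mul, Int.units_sq]

theorem levelSign_succ_grigB (n : ℕ) : levelSign (n + 3) grigB = levelSign (n + 2) grigC := by
  rw [levelSign_succ_of_fixes_first_letter grigB_smul_cons, Fintype.prod_bool, cond_true,
    cond_false, levelSign_grigA, mul_one]

theorem levelSign_succ_grigC (n : ℕ) : levelSign (n + 3) grigC = levelSign (n + 2) grigD := by
  rw [levelSign_succ_of_fixes_first_letter grigC_smul_cons, Fintype.prod_bool, cond_true,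
    cond_false, levelSign_grigA, mul_one]

theorem levelSign_succ_grigD (n : ℕ) : levelSign (n + 3) grigD = levelSign (n + 2) grigB := by
  rw [levelSign_succ_of_fixes_first_letter grigD_smul_cons, Fintype.prod_bool, cond_true,
    cond_false, map_one, mul_one]

theorem levelSign_mul_mul_eq_one {g : treeAut} (hg : g ∈ grigorchukGroup) (n : ℕ) :
    levelSign (n + 2) g * levelSign (n + 3) g * levelSign (n + 4) g = 1 := by
  have hbcd : levelSign (n + 2) grigB * levelSign (n + 2) grigC * levelSign (n + 2) grigD = 1 := by
    rw [← grigB_mul_grigC, map_mul, Int.units_mul_self]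
  suffices hker : grigorchukGroup ≤
      (levelSign (n + 2) * levelSign (n + 3) * levelSign (n + 4)).ker from hker hg
  refine (Subgroup.closure_le _).2 ?_
  rintro s (rfl | rfl | rfl | rfl) <;>
    rw [SetLike.mem_coe, MonoidHom.mem_ker, MonoidHom.mul_apply, MonoidHom.mul_apply]
  · rw [levelSign_grigA, levelSign_grigA (n + 1), levelSign_grigA (n + 2), mul_one, mul_one]
  · rw [levelSign_succ_grigB (n + 1), levelSign_succ_grigB, levelSign_succ_grigC, hbcd]
  · rw [levelSign_succ_grigC (n + 1), levelSign_succ_grigC, levelSign_succ_grigD, mul_comm,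
      ← mul_assoc, hbcd]
  · rw [levelSign_succ_grigD (n + 1), levelSign_succ_grigD, levelSign_succ_grigB, mul_assoc,
      mul_comm, hbcd]

theorem exists_ne_swapsChildren {g : treeAut} (hg : g ∈ grigorchukGroup) {n : ℕ}
    (hfix : ∀ u : List Bool, u.length ≤ n + 3 → g • u = u) {v : List Bool}
    (hv : v.length = n + 3) (hgv : SwapsChildren g v) :
    ∃ u : List Bool, u.length = n + 3 ∧ u ≠ v ∧ SwapsChildren g u := by
  by_contra! hother
  have hrel := levelSign_mul_mul_eq_one hg n
  rw [levelSign_eq_one fun u hu => hfix u (by omega),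
    levelSign_eq_one fun u hu => hfix u (by omega),
    levelSign_succ_eq_neg_one (fun u hu => hfix u hu.le) hv hgv hother] at hrel
  exact absurd hrel (by decide)

theorem exists_swapsChildren_append_ne {g : treeAut} (hg : g ∈ grigorchukGroup) {n : ℕ}
    {w s : List Bool} (hfix : ∀ u : List Bool, u.length ≤ w.length + (n + 3) → g • u = u)
    (hs : s.length = n + 3) (hgs : SwapsChildren g (w ++ s)) (r : List Bool) :
    ∃ t : List Bool, t.length = n + 3 ∧ t ≠ r ∧ SwapsChildren g (w ++ t) := by
  by_cases hsr : s = r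
  · subst hsr
    have hw : g • w = w := hfix w (Nat.le_add_right _ _)
    obtain ⟨h, hh, hsec⟩ := exists_isSectionAt hg w
    have hhfix (u : List Bool) (hu : u.length ≤ n + 3) : h • u = u :=
      (hsec.smul_eq_iff hw u u).1 (hfix _ (by rw [List.length_append]; omega))
    obtain ⟨t, ht, hts, hht⟩ :=
      exists_ne_swapsChildren hh hhfix hs ((hsec.swapsChildren_iff hw s).1 hgs)
    exact ⟨t, ht, hts, (hsec.swapsChildren_iff hw t).2 hht⟩
  · exact ⟨s, hs, hsr, hgs⟩

end GrigorchukGroup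

section SegmentPositions

/-- The position of a word along the Schreier graph of its level, which is a segment, counted from
the end `1ⁿ`. The generator `a` exchanges the positions `2k` and `2k + 1`, and the other generators
exchange some of the pairs `2k + 1`, `2k + 2`, so that this is a reflected Gray code. -/
def grayPos : List Bool → ℕ
  | [] => 0
  | x :: w => 2 * grayPos w + (grayPos w + (!x).toNat) % 2

theorem grayPos_lt (w : List Bool) : grayPos w < 2 ^ w.length := by
  induction w with
  | nil => simp [grayPos]
  | cons x w ih =>
    simp only [grayPos, List.length_cons, pow_succ]
    omega

theorem grayPos_injOn_length (n : ℕ) : Set.InjOn grayPos {w | w.length = n} := by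
  intro v hv w hw h
  induction n generalizing v w with
  | zero => rw [List.length_eq_zero_iff.1 hv, List.length_eq_zero_iff.1 hw]
  | succ n ih =>
    obtain ⟨x, v, rfl⟩ := List.exists_cons_of_length_eq_add_one hv
    obtain ⟨y, w, rfl⟩ := List.exists_cons_of_length_eq_add_one hw
    simp only [grayPos] at h
    obtain rfl : v = w := ih (Nat.succ_injective hv) (Nat.succ_injective hw) (by omega)
    have hx := Bool.toNat_le (!x)
    have hy := Bool.toNat_le (!y)
    have hxy : (!x).toNat = (!y).toNat := by omega
    cases x <;> cases y <;> first | rfl | simp at hxy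

theorem grayPos_append_true (w : List Bool) : grayPos (w ++ [true]) = grayPos w := by
  induction w with
  | nil => simp [grayPos]
  | cons x w ih => simp only [List.cons_append, grayPos, ih]

theorem grayPos_append_false_add (w : List Bool) :
    grayPos (w ++ [false]) + grayPos w + 1 = 2 ^ (w.length + 1) := by
  induction w with
  | nil => simp [grayPos]
  | cons x w ih =>
    simp only [List.cons_append, grayPos, List.length_cons, pow_succ] at ih ⊢
    omega

theorem grayPos_append_lt (v w : List Bool) :
    grayPos (v ++ w) < 2 ^ v.length * (grayPos w + 1) := by
  induction v with
  | nil => simp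
  | cons x v ih =>
    simp only [List.cons_append, grayPos, List.length_cons, pow_succ]
    rw [mul_right_comm]
    omega

theorem grayPos_grigAFun_div_two (w : List Bool) : grayPos (grigAFun w) / 2 = grayPos w / 2 := by
  cases w with
  | nil => rfl
  | cons x w => simp only [grigAFun, grayPos]; omega

theorem grayPos_cons_false_succ_div_two {v w : List Bool} (h : grayPos v / 2 = grayPos w / 2) :
    (grayPos (false :: v) + 1) / 2 = (grayPos (false :: w) + 1) / 2 := by
  simp only [grayPos, Bool.not_false, Bool.toNat_true]
  omega

theorem grayPos_cons_true_succ_div_two {v w : List Bool}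
    (h : (grayPos v + 1) / 2 = (grayPos w + 1) / 2) :
    (grayPos (true :: v) + 1) / 2 = (grayPos (true :: w) + 1) / 2 := by
  simp only [grayPos, Bool.not_true, Bool.toNat_false]
  omega

theorem grayPos_grigBCDFun_succ_div_two (w : List Bool) :
    (grayPos (grigBFun w) + 1) / 2 = (grayPos w + 1) / 2 ∧
      (grayPos (grigCFun w) + 1) / 2 = (grayPos w + 1) / 2 ∧
      (grayPos (grigDFun w) + 1) / 2 = (grayPos w + 1) / 2 := by
  induction w with
  | nil => exact ⟨rfl, rfl, rfl⟩
  | cons x w ih =>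
    cases x
    · have hA := grayPos_cons_false_succ_div_two (grayPos_grigAFun_div_two w)
      exact ⟨hA, hA, rfl⟩
    · exact ⟨grayPos_cons_true_succ_div_two ih.2.1, grayPos_cons_true_succ_div_two ih.2.2,
        grayPos_cons_true_succ_div_two ih.1⟩

theorem abs_sub_le_one_of_add_div_two_eq {p q r : ℕ} (h : (q + r) / 2 = (p + r) / 2) :
    |(q : ℤ) - p| ≤ 1 :=
  abs_le.2 (by omega)

theorem isLipschitzPotential_grayPos :
    IsLipschitzPotential grigorchukGenerators fun w : List Bool => (grayPos w : ℤ) := by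
  rintro ⟨s, _⟩ hs w
  obtain ⟨hB, hC, hD⟩ := grayPos_grigBCDFun_succ_div_two w
  rcases hs with rfl | rfl | rfl | rfl
  · exact abs_sub_le_one_of_add_div_two_eq (r := 0) (grayPos_grigAFun_div_two w)
  · exact abs_sub_le_one_of_add_div_two_eq hB
  · exact abs_sub_le_one_of_add_div_two_eq hC
  · exact abs_sub_le_one_of_add_div_two_eq hD

end SegmentPositions

section Displacement

theorem SwapsChildren.grayPos_sub {g : treeAut} {v : List Bool} (hgv : SwapsChildren g v) :
    (grayPos (g • (v ++ [true])) : ℤ) - grayPos (v ++ [true]) =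
      2 ^ (v.length + 1) - 1 - 2 * grayPos v := by
  have hfalse : (grayPos (v ++ [false]) : ℤ) + grayPos v + 1 = 2 ^ (v.length + 1) := by
    exact_mod_cast grayPos_append_false_add v
  rw [hgv.2, Bool.not_true, grayPos_append_true]
  linarith

theorem exists_swapsChildren_grayPos_le {g : treeAut} (hg : g ∈ grigorchukGroup) {v : List Bool}
    (hv : 3 ≤ v.length) (hgv : SwapsChildren g v)
    (hfix : ∀ u : List Bool, u.length ≤ v.length → g • u = u) :
    ∃ u : List Bool, SwapsChildren g u ∧ 8 * (grayPos u + 1) ≤ 7 * 2 ^ u.length := by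
  obtain ⟨w, s, rfl, hs⟩ : ∃ w s : List Bool, v = w ++ s ∧ s.length = 3 :=
    ⟨v.take (v.length - 3), v.drop (v.length - 3), (List.take_append_drop _ _).symm, by
      rw [List.length_drop]; omega⟩
  rw [List.length_append, hs] at hfix
  obtain ⟨t, ht, hne, hgt⟩ :=
    exists_swapsChildren_append_ne (n := 0) hg hfix hs hgv [true, true, false]
  have ht7 : grayPos t ≠ 7 := fun h => hne (grayPos_injOn_length 3 ht rfl h)
  have ht8 : grayPos t < 2 ^ 3 := by simpa only [ht] using grayPos_lt t
  have hwt := grayPos_append_lt w t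
  have hmul : 2 ^ w.length * (grayPos t + 1) ≤ 2 ^ w.length * 7 :=
    Nat.mul_le_mul_left _ (by omega)
  refine ⟨w ++ t, hgt, ?_⟩
  rw [List.length_append, ht, pow_add]
  omega

theorem exists_grayPos_displacement {g : grigorchukGroup} (hg : g ≠ 1) :
    ∃ w : List Bool, w ≠ [] ∧
      (2 : ℤ) ^ w.length ≤ 8 * |(grayPos (g • w) : ℤ) - grayPos w| + 1 := by
  -- For `w = v1` the claimed inequality reads `2 ^ m ≤ 8 * (2 ^ m - 1 - 2 * grayPos v) + 1`
  -- with `m = v.length + 1`.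
  obtain ⟨v, hgv, hv⟩ : ∃ v : List Bool, SwapsChildren g.1 v ∧
      16 * grayPos v + 7 ≤ 14 * 2 ^ v.length := by
    obtain ⟨v, hgv, hfix⟩ := exists_swapsChildren_of_ne_one (OneMemClass.coe_eq_one.not.2 hg)
    by_cases hlen : 3 ≤ v.length
    · obtain ⟨u, hgu, hu⟩ := exists_swapsChildren_grayPos_le g.2 hlen hgv hfix
      exact ⟨u, hgu, by omega⟩
    · have hpos := grayPos_lt v
      have hpow : 2 ^ v.length ≤ 2 ^ 2 := Nat.pow_le_pow_right two_pos (by omega)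
      exact ⟨v, hgv, by omega⟩
  refine ⟨v ++ [true], by simp, ?_⟩
  rw [Subgroup.smul_def, hgv.grayPos_sub, List.length_append, List.length_singleton, pow_succ]
  have hv' : 16 * (grayPos v : ℤ) + 7 ≤ 14 * 2 ^ v.length := by exact_mod_cast hv
  linarith [hv', le_abs_self ((2 : ℤ) ^ v.length * 2 - 1 - 2 * grayPos v)]

end Displacement

section ControlledDiameter

theorem closure_grigorchukGenerators : Subgroup.closure grigorchukGenerators = ⊤ :=
  Subgroup.closure_closure_coe_preimage

theorem finite_grigorchukGenerators : grigorchukGenerators.Finite :=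
  (Set.toFinite ({grigA, grigB, grigC, grigD} : Set treeAut)).preimage Subtype.val_injective.injOn

theorem inv_mem_grigorchukGenerators {s : grigorchukGroup} (hs : s ∈ grigorchukGenerators) :
    s⁻¹ ∈ grigorchukGenerators := by
  rwa [show s⁻¹ = s from Subtype.ext (generator_inv hs)]

theorem orbit_subset_length_eq (w : List Bool) :
    MulAction.orbit grigorchukGroup w ⊆ {u | u.length = w.length} := by
  rintro _ ⟨g, rfl⟩
  exact treeAut_length g w

theorem finite_orbit (w : List Bool) : (MulAction.orbit grigorchukGroup w).Finite :=
  (List.finite_length_eq Bool _).subset (orbit_subset_length_eq w)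

theorem natCard_orbit_le (w : List Bool) :
    Nat.card (MulAction.orbit grigorchukGroup w) ≤ 2 ^ w.length :=
  (Nat.card_mono (List.finite_length_eq Bool _) (orbit_subset_length_eq w)).trans_eq
    ((Nat.card_eq_fintype_card (α := Level w.length)).trans (Level.card _))

theorem hasOrbitsOfControlledDiameter_words :
    HasOrbitsOfControlledDiameter grigorchukGenerators (List Bool) := by
  refine isLipschitzPotential_grayPos.hasOrbitsOfControlledDiameter closure_grigorchukGenerators
    finite_orbit (C := 8) (by norm_num) fun g hg => ?_
  obtain ⟨w, hw, hdisp⟩ := exists_grayPos_displacement hg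
  refine ⟨w, fun hgw => ?_, ?_⟩
  · rw [hgw, sub_self, abs_zero, mul_zero, zero_add] at hdisp
    exact absurd hdisp (not_le.2 (one_lt_pow₀ one_lt_two (List.length_eq_zero_iff.not.2 hw)))
  · refine (Nat.cast_le.2 (natCard_orbit_le w)).trans ?_
    exact_mod_cast hdisp

theorem diam_grigorchukSchreierGraph_lt (n : ℕ) : (grigorchukSchreierGraph n).diam < 2 ^ n := by
  simpa only [Nat.card_eq_fintype_card, Level.card] using
    diam_lt_natCard (grigorchukSchreierGraph n)

theorem abs_sub_grayPos_le_dist {n : ℕ} (g : grigorchukGroup) (w : Level n) :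
    |(grayPos (g • w).1 : ℤ) - grayPos w.1| ≤ (grigorchukSchreierGraph n).dist w (g • w) := by
  have hlevel : IsLipschitzPotential grigorchukGenerators
      fun u : Level n => (grayPos u.1 : ℤ) :=
    fun s hs u => isLipschitzPotential_grayPos s hs u.1
  exact hlevel.abs_sub_smul_le_dist closure_grigorchukGenerators g w

theorem inClassCD_grigorchukGroup : InClassCD (fun n => n) grigorchukGroup := by
  refine ⟨grigorchukGenerators, finite_grigorchukGenerators, fun _ => inv_mem_grigorchukGenerators,
    closure_grigorchukGenerators, List Bool, inferInstance, hasOrbitsOfControlledDiameter_words,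
    isLipschitzPotential_grayPos.growthLE_linear fun w => ?_⟩
  exact (Nat.cast_injective.comp_injOn (grayPos_injOn_length w.length)).mono
    (orbit_subset_length_eq w)

end ControlledDiameter

theorem mainTheorem6 :
    (∀ g : grigorchukGroup, g ≠ 1 → ∃ n : ℕ, 1 ≤ n ∧ ∃ w : Level n,
      ((grigorchukSchreierGraph n).diam : ℝ) / 8 ≤
        ((grigorchukSchreierGraph n).dist (g • w) w : ℝ)) ∧
    InClassCD (fun n => n) grigorchukGroup := by
  refine ⟨fun g hg => ?_, inClassCD_grigorchukGroup⟩
  obtain ⟨w, hw, hdisp⟩ := exists_grayPos_displacement hg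
  let x : Level w.length := ⟨w, rfl⟩
  refine ⟨w.length, List.length_pos_iff.2 hw, x, ?_⟩
  have hdiam : ((grigorchukSchreierGraph w.length).diam : ℤ) + 1 ≤ 2 ^ w.length := by
    exact_mod_cast diam_grigorchukSchreierGraph_lt w.length
  have hdist : |(grayPos (g • w) : ℤ) - grayPos w| ≤
      (grigorchukSchreierGraph w.length).dist x (g • x) := abs_sub_grayPos_le_dist g x
  rw [div_le_iff₀ (by norm_num), SimpleGraph.dist_comm]
  exact_mod_cast (by linarith : ((grigorchukSchreierGraph w.length).diam : ℤ) ≤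
    (grigorchukSchreierGraph w.length).dist x (g • x) * 8)
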